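/- For a positive integer $n$ let $\mathcal N(n)$ denote the number of isomorphism types of groups of order $n$. For positive integers $r, s$ let $w_r(s) = 1$ if $s$ divides $r$, and $w_r(s) = 0$ otherwise. Let $p$ and $q$ be different primes. (a) If $q = 2$, then $\mathcal N(p^2 q) = 5$. (b) If $q > 2$, then \[ \mathcal N(p^2 q) = 2 + \frac{q+5}{2}\, w_{p-1}(q) + w_{p+1}(q) + 2\, w_{q-1}(p) + w_{q-1}(p^2). \] -/

import Mathlib

/-- Isomorphism of groups, as an equivalence relation on the groups of order `n`. Every finite group
is isomorphic to one whose underlying type lives in `Type`, so the lowest universe suffices. -/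
def groupIsoSetoid (n : ℕ) : Setoid {G : GrpCat.{0} // Nat.card G = n} where
  r G H := Nonempty (G.1 ≃* H.1)
  iseqv :=
    { refl := fun G => ⟨MulEquiv.refl G.1⟩
      symm := fun ⟨e⟩ => ⟨e.symm⟩
      trans := fun ⟨e⟩ ⟨f⟩ => ⟨e.trans f⟩ }

/-- The number of isomorphism types of groups of order `n`, for `n ≥ 1`. -/
noncomputable def numGroups (n : ℕ) : ℕ :=
  Nat.card (Quotient (groupIsoSetoid n))

/-- `w r s` is `1` if `s` divides `r`, and `0` otherwise. -/
def w (r s : ℕ) : ℕ := if s ∣ r then 1 else 0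

/-! A group of order p²q is a semidirect product of a Sylow p-subgroup and a Sylow q-subgroup, one
of which is normal (`exists_normal_complement`). As the orders are coprime and the normal factor is
abelian, two such products with the same factors are isomorphic exactly when the actions agree up to
automorphisms of both factors (`nonempty_semidirectProduct_mulEquiv_iff`). The Sylow p-subgroup is
cyclic or elementary abelian, so there are four families of actions to count. The two families for a
given Sylow p-subgroup share only the direct product, and different Sylow p-subgroups give disjoint
families; hence `numGroups_add_two`.

In three families the acted-on group has a cyclic automorphism group, and the order of the image
classifies the action (`ncard_splitTypes_of_isCyclic_mulAut`, `ncard_splitTypes_zmod_prod`). The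
fourth is ℤ/q acting on (ℤ/p)², that is, mapping to GL₂(p). If q ∣ p - 1, every action is
diagonalizable and is given by a pair of exponents mod q, up to scaling and swapping
(`ncard_splitTypes_of_dvd_sub_one`). If q divides p + 1 but not p - 1, every action is conjugate
into the cyclic subgroup coming from the units of the field of order p², so there is one nontrivial
class. Otherwise the action is trivial. -/

/-! ### Equivalent actions and isomorphic semidirect products -/

/-- Two actions of `K` on `N` are equivalent if they agree up to automorphisms of `N` and `K`. -/
def ActionEquiv {N K : Type*} [Group N] [Group K] (φ ψ : K →* MulAut N) : Prop :=
  ∃ a : MulAut N, ∃ b : MulAut K, ∀ k, ψ (b k) = a * φ k * a⁻¹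

theorem ActionEquiv.refl {N K : Type*} [Group N] [Group K] (φ : K →* MulAut N) :
    ActionEquiv φ φ := ⟨1, 1, fun k => by simp⟩

theorem ActionEquiv.symm {N K : Type*} [Group N] [Group K] {φ ψ : K →* MulAut N}
    (h : ActionEquiv φ ψ) : ActionEquiv ψ φ := by
  obtain ⟨a, b, h⟩ := h
  refine ⟨a⁻¹, b⁻¹, fun k => ?_⟩
  have := h (b⁻¹ k)
  rw [MulAut.apply_inv_self] at this
  rw [this]
  group

theorem ActionEquiv.trans {N K : Type*} [Group N] [Group K] {φ ψ χ : K →* MulAut N}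
    (h : ActionEquiv φ ψ) (h' : ActionEquiv ψ χ) : ActionEquiv φ χ := by
  obtain ⟨a, b, h⟩ := h
  obtain ⟨a', b', h'⟩ := h'
  refine ⟨a' * a, b' * b, fun k => ?_⟩
  rw [MulAut.mul_apply, h', h]
  group

theorem SemidirectProduct.left_conj_inl {N K : Type*} [CommGroup N] [Group K]
    {ψ : K →* MulAut N} (x : N ⋊[ψ] K) (m : N) :
    (x * SemidirectProduct.inl m * x⁻¹).left = ψ x.right m := by
  simp [mul_comm]

theorem MonoidHom.apply_eq_one_of_coprime {A B : Type*} [Group A] [Group B]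
    (f : A →* B) (h : (Nat.card A).Coprime (Nat.card B)) (a : A) : f a = 1 := by
  rw [← orderOf_eq_one_iff]
  exact Nat.eq_one_of_dvd_coprimes h
    ((orderOf_map_dvd f a).trans (orderOf_dvd_natCard a)) (orderOf_dvd_natCard _)

/-- Coprimality kills the map from `N` to `K` induced by an isomorphism, so the isomorphism
preserves `N` and induces automorphisms of `N` and of the quotient `K`. It need not preserve the
complement `K`, but the error lies in `N`, which is commutative and so acts trivially on itself by
conjugation. -/
theorem nonempty_semidirectProduct_mulEquiv_iff {N K : Type*} [CommGroup N] [Group K]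
    [Finite N] [Finite K] (h : (Nat.card N).Coprime (Nat.card K)) (φ ψ : K →* MulAut N) :
    Nonempty (N ⋊[φ] K ≃* N ⋊[ψ] K) ↔ ActionEquiv φ ψ := by
  constructor
  · rintro ⟨e⟩
    have right_inl : ∀ (φ ψ : K →* MulAut N) (e : N ⋊[φ] K ≃* N ⋊[ψ] K) (n : N),
        (e (SemidirectProduct.inl n)).right = 1 := fun φ ψ e n =>
      MonoidHom.apply_eq_one_of_coprime
        (SemidirectProduct.rightHom.comp (e.toMonoidHom.comp SemidirectProduct.inl)) h n
    have inl_left : ∀ (φ : K →* MulAut N) (x : N ⋊[φ] K), x.right = 1 →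
        SemidirectProduct.inl x.left = x := fun φ x hx => by
      ext <;> simp [hx]
    let α : N →* N :=
      { toFun := fun n => (e (SemidirectProduct.inl n)).left
        map_one' := by simp
        map_mul' := fun x y => by simp [right_inl φ ψ e] }
    have hα : ∀ n, e (SemidirectProduct.inl n) = SemidirectProduct.inl (α n) := fun n =>
      (inl_left ψ _ (right_inl φ ψ e n)).symm
    let β : K →* K := SemidirectProduct.rightHom.comp (e.toMonoidHom.comp SemidirectProduct.inr)
    have hβ : ∀ k, (e (SemidirectProduct.inr k)).right = β k := fun k => rfl
    have αinj : Function.Injective α := fun x y hxy => by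
      have := (hα x).trans ((congrArg _ hxy).trans (hα y).symm)
      simpa using this
    have βinj : Function.Injective β := by
      rw [injective_iff_map_eq_one]
      intro k hk
      have h1 := inl_left ψ (e (SemidirectProduct.inr k)) hk
      have h2 := right_inl ψ φ e.symm (e (SemidirectProduct.inr k)).left
      rw [h1] at h2
      simpa using h2
    let a : MulAut N := MulEquiv.ofBijective α (Finite.injective_iff_bijective.mp αinj)
    let b : MulAut K := MulEquiv.ofBijective β (Finite.injective_iff_bijective.mp βinj)
    have key : ∀ k n, a (φ k n) = ψ (b k) (a n) := fun k n => by
      have h1 := congrArg e (SemidirectProduct.inl_aut (φ := φ) k n)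
      rw [map_mul, map_mul, map_inv, map_inv, hα, hα] at h1
      have h2 := congrArg SemidirectProduct.left h1
      rw [SemidirectProduct.left_conj_inl] at h2
      exact h2
    refine ⟨a, b, fun k => ?_⟩
    rw [eq_mul_inv_iff_mul_eq]
    ext n
    exact (key k n).symm
  · rintro ⟨a, b, hab⟩
    refine ⟨SemidirectProduct.congr a b fun k => ?_⟩
    ext n
    have := hab k
    rw [eq_mul_inv_iff_mul_eq] at this
    exact (DFunLike.congr_fun this n).symm

/-! ### Isomorphism types within one family of semidirect products -/

/-- The isomorphism types of groups of order `n` that are semidirect products of `N` by `K`. -/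
def splitTypes (n : ℕ) (N K : Type) [Group N] [Group K] : Set (Quotient (groupIsoSetoid n)) :=
  {t | ∃ G : {G : GrpCat.{0} // Nat.card G = n}, t = Quotient.mk _ G ∧
    ∃ φ : K →* MulAut N, Nonempty (G.1 ≃* N ⋊[φ] K)}

theorem mk_mem_splitTypes {n : ℕ} {N K : Type} [Group N] [Group K]
    {G : {G : GrpCat.{0} // Nat.card G = n}} :
    Quotient.mk _ G ∈ splitTypes n N K ↔ ∃ φ : K →* MulAut N, Nonempty (G.1 ≃* N ⋊[φ] K) := by
  constructor
  · rintro ⟨H, hH, φ, ⟨e⟩⟩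
    obtain ⟨f⟩ := Quotient.exact hH
    exact ⟨φ, ⟨f.trans e⟩⟩
  · exact fun h => ⟨G, rfl, h⟩

theorem ncard_range_eq_of_ker_eq {X A B : Type*} (f : X → A) (g : X → B)
    (h : ∀ x y, f x = f y ↔ g x = g y) : (Set.range f).ncard = (Set.range g).ncard := by
  have hk : Setoid.ker f = Setoid.ker g := Setoid.ext h
  rw [← Nat.card_coe_set_eq, ← Nat.card_coe_set_eq,
    ← Nat.card_congr (Setoid.quotientKerEquivRange f),
    ← Nat.card_congr (Setoid.quotientKerEquivRange g), hk]

/-- Reduces counting groups to finding actions `Ψ` that meet every class, together with a complete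
numerical invariant `label` of them. -/
theorem ncard_splitTypes {n : ℕ} {N K : Type} [CommGroup N] [Group K] [Finite N] [Finite K]
    (hn : Nat.card N * Nat.card K = n) (h : (Nat.card N).Coprime (Nat.card K))
    {X : Type*} (Ψ : X → (K →* MulAut N)) (hΨ : ∀ φ, ∃ x, ActionEquiv φ (Ψ x))
    (label : X → ℕ) (hl : ∀ x y, label x = label y ↔ ActionEquiv (Ψ x) (Ψ y)) :
    (splitTypes n N K).ncard = (Set.range label).ncard := by
  let f : X → Quotient (groupIsoSetoid n) := fun x =>
    Quotient.mk _ ⟨GrpCat.of (N ⋊[Ψ x] K), by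
      rw [← hn]; exact SemidirectProduct.card⟩
  have hf : splitTypes n N K = Set.range f := by
    ext t
    constructor
    · rintro ⟨G, rfl, φ, ⟨e⟩⟩
      obtain ⟨x, hx⟩ := hΨ φ
      obtain ⟨e'⟩ := (nonempty_semidirectProduct_mulEquiv_iff h φ (Ψ x)).mpr hx
      exact ⟨x, Quotient.sound ⟨(e.trans e').symm⟩⟩
    · rintro ⟨x, rfl⟩
      exact ⟨_, rfl, Ψ x, ⟨MulEquiv.refl _⟩⟩
  rw [hf]
  refine ncard_range_eq_of_ker_eq f label fun x y => ?_
  rw [hl, ← nonempty_semidirectProduct_mulEquiv_iff h]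
  exact Quotient.eq

/-- A group that is a semidirect product both ways, of coprime orders, is the direct product. -/
theorem action_eq_one_of_mulEquiv {N K : Type*} [CommGroup N] [CommGroup K]
    (h : (Nat.card N).Coprime (Nat.card K)) {φ : K →* MulAut N} {ψ : N →* MulAut K}
    (e : N ⋊[φ] K ≃* K ⋊[ψ] N) : φ = 1 := by
  -- Such an `x` lies in `N` on one side and in `K` on the other, so its order divides two coprime
  -- numbers. Commutators qualify because both quotients are commutative; hence the group is
  -- commutative.
  have hinj : ∀ x : N ⋊[φ] K, x.right = 1 → (e x).right = 1 → x = 1 := by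
    intro x hx hx'
    have h1 : SemidirectProduct.inl x.left = x := by ext <;> simp [hx]
    have h2 : SemidirectProduct.inl (e x).left = e x := by ext <;> simp [hx']
    rw [← orderOf_eq_one_iff]
    refine Nat.eq_one_of_dvd_coprimes h ?_ ?_
    · rw [← h1]
      exact (orderOf_map_dvd _ _).trans (orderOf_dvd_natCard _)
    · rw [← MulEquiv.orderOf_eq e, ← h2]
      exact (orderOf_map_dvd _ _).trans (orderOf_dvd_natCard _)
  have hcomm : ∀ x y : N ⋊[φ] K, x * y = y * x := by
    intro x y
    rw [← mul_inv_eq_one]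
    apply hinj
    · simp only [SemidirectProduct.mul_right, SemidirectProduct.inv_right]
      rw [mul_inv_eq_one, mul_comm]
    · simp only [map_mul, map_inv, SemidirectProduct.mul_right, SemidirectProduct.inv_right]
      rw [mul_inv_eq_one, mul_comm]
  ext k n
  have := SemidirectProduct.inl_aut (φ := φ) k n
  rw [hcomm (SemidirectProduct.inr k), mul_assoc, ← map_mul] at this
  simpa using this

theorem splitTypes_inter {n : ℕ} {N K : Type} [CommGroup N] [CommGroup K]
    (hn : Nat.card N * Nat.card K = n) (h : (Nat.card N).Coprime (Nat.card K)) :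
    (splitTypes n N K ∩ splitTypes n K N).ncard = 1 := by
  rw [Set.ncard_eq_one]
  refine ⟨Quotient.mk _ ⟨GrpCat.of (N × K), by rw [← hn]; exact Nat.card_prod N K⟩, ?_⟩
  ext t
  constructor
  · rintro ⟨⟨G, rfl, φ, ⟨e⟩⟩, h'⟩
    obtain ⟨ψ, ⟨e'⟩⟩ := mk_mem_splitTypes.mp h'
    obtain rfl := action_eq_one_of_mulEquiv h (e.symm.trans e')
    exact Quotient.sound ⟨e.trans SemidirectProduct.mulEquivProd⟩
  · rintro rfl
    exact ⟨mk_mem_splitTypes.mpr ⟨1, ⟨SemidirectProduct.mulEquivProd.symm⟩⟩,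
      mk_mem_splitTypes.mpr
        ⟨1, ⟨(MulEquiv.prodComm).trans SemidirectProduct.mulEquivProd.symm⟩⟩⟩

/-! ### Groups of order p², and splitting of groups of order p²q -/

theorem natCard_multiplicative_zmod (n : ℕ) : Nat.card (Multiplicative (ZMod n)) = n :=
  (Nat.card_congr Multiplicative.toAdd).trans (Nat.card_zmod n)

theorem natCard_multiplicative_zmod_prod (n : ℕ) :
    Nat.card (Multiplicative (ZMod n × ZMod n)) = n ^ 2 := by
  rw [Nat.card_congr Multiplicative.toAdd, Nat.card_prod, Nat.card_zmod, sq]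

theorem exists_mulEquiv_semidirectProduct {G N K : Type*} [Group G] [Group N] [Group K]
    {H L : Subgroup G} [H.Normal] (h : H.IsComplement' L) (e : H ≃* N) (f : L ≃* K) :
    ∃ φ : K →* MulAut N, Nonempty (G ≃* N ⋊[φ] K) :=
  ⟨_, ⟨(SemidirectProduct.mulEquivSubgroup h).symm.trans (SemidirectProduct.congr' e f)⟩⟩

theorem nonempty_addEquiv_zmod_prod {V : Type*} [AddCommGroup V] {p : ℕ} (hp : p.Prime)
    [Module (ZMod p) V] (h : Nat.card V = p ^ 2) : Nonempty (V ≃+ ZMod p × ZMod p) := by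
  have := Fact.mk hp
  have : Finite V := Nat.finite_of_card_ne_zero (h ▸ pow_ne_zero 2 hp.ne_zero)
  have : Module.Finite (ZMod p) V := Module.Finite.of_finite
  have hfr : Module.finrank (ZMod p) V = 2 := by
    have h1 := Module.natCard_eq_pow_finrank (K := ZMod p) (V := V)
    rw [Nat.card_zmod] at h1
    exact Nat.pow_right_injective hp.two_le (h1.symm.trans h)
  have e : V ≃ₗ[ZMod p] ZMod p × ZMod p := LinearEquiv.ofFinrankEq _ _ (by simp [hfr])
  exact ⟨e.toAddEquiv⟩

/-- A noncyclic group of order p² is abelian of exponent p, hence a plane over the field with p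
elements. -/
theorem mulEquiv_of_card_prime_sq {P : Type*} [Group P] {p : ℕ} (hp : p.Prime)
    (h : Nat.card P = p ^ 2) :
    Nonempty (P ≃* Multiplicative (ZMod (p ^ 2))) ∨
      Nonempty (P ≃* Multiplicative (ZMod p × ZMod p)) := by
  have := Fact.mk hp
  by_cases hc : IsCyclic P
  · left
    exact ⟨mulEquivOfCyclicCardEq (by simp [h])⟩
  · right
    have hexp := (not_isCyclic_iff_exponent_eq_prime hp h).mp hc
    let : CommGroup P := IsPGroup.commGroupOfCardEqPrimeSq h
    let : Module (ZMod p) (Additive P) := AddCommGroup.zmodModule fun x => by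
      have := Monoid.pow_exponent_eq_one x.toMul
      rw [hexp] at this
      exact this
    obtain ⟨e⟩ := nonempty_addEquiv_zmod_prod hp (V := Additive P) h
    exact ⟨AddEquiv.toMultiplicativeRight e⟩

/-- A group of order `p ^ 2 * q` has a normal Sylow subgroup with a complement. -/
theorem exists_normal_complement {G : Type*} [Group G] {p q : ℕ} (hp : p.Prime) (hq : q.Prime)
    (hpq : p ≠ q) (hG : Nat.card G = p ^ 2 * q) :
    ∃ H L : Subgroup G, H.Normal ∧ H.IsComplement' L ∧
      ((Nat.card H = p ^ 2 ∧ Nat.card L = q) ∨ (Nat.card H = q ∧ Nat.card L = p ^ 2)) := by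
  have := Fact.mk hp
  have := Fact.mk hq
  have hpos : 0 < p ^ 2 * q := Nat.mul_pos (pow_pos hp.pos 2) hq.pos
  have hfin : Finite G := Nat.finite_of_card_ne_zero (hG ▸ hpos.ne')
  have hco : (p ^ 2).Coprime q := Nat.Coprime.pow_left 2 ((Nat.coprime_primes hp hq).mpr hpq)
  obtain ⟨P⟩ : Nonempty (Sylow p G) := inferInstance
  obtain ⟨Q⟩ : Nonempty (Sylow q G) := inferInstance
  have fq : (p ^ 2 * q).factorization q = 1 := by
    rw [Nat.factorization_mul (by positivity [hp.pos]) hq.ne_zero]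
    simp [hq.factorization, hp.factorization, hpq]
  have fp : (p ^ 2 * q).factorization p = 2 := by
    rw [Nat.factorization_mul (by positivity [hp.pos]) hq.ne_zero]
    simp [hq.factorization, hp.factorization, hpq.symm]
  have hP : Nat.card P = p ^ 2 := by
    rw [P.card_eq_multiplicity, hG, fp]
  have hQ : Nat.card Q = q := by
    rw [Q.card_eq_multiplicity, hG, fq, pow_one]
  have hPi : P.index = q := by
    have := (P : Subgroup G).card_mul_index
    rw [hG, hP] at this
    exact Nat.eq_of_mul_eq_mul_left (pow_pos hp.pos 2) this
  have hQi : Q.index = p ^ 2 := by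
    have := (Q : Subgroup G).card_mul_index
    rw [hG, hQ, mul_comm] at this
    exact Nat.eq_of_mul_eq_mul_right hq.pos this
  have hcompl : Subgroup.IsComplement' (P : Subgroup G) (Q : Subgroup G) :=
    Subgroup.isComplement'_of_coprime (by rw [hP, hQ, hG]) (by rw [hP, hQ]; exact hco)
  have normal_of_one : ∀ {r : ℕ} [Fact r.Prime] (S : Sylow r G), Nat.card (Sylow r G) = 1 →
      (S : Subgroup G).Normal := by
    intro r _ S h
    rw [S.card_eq_index_normalizer, Subgroup.index_eq_one] at h
    exact Subgroup.normalizer_eq_top_iff.mp h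
  have hnq : Nat.card (Sylow q G) ∣ p ^ 2 := hQi ▸ Q.card_dvd_index
  have hnp : Nat.card (Sylow p G) ∣ q := hPi ▸ P.card_dvd_index
  have cP : (P : Subgroup G).Normal → _ := fun h =>
    (⟨P, Q, h, hcompl, Or.inl ⟨hP, hQ⟩⟩ : ∃ H L : Subgroup G, H.Normal ∧ H.IsComplement' L ∧
      ((Nat.card H = p ^ 2 ∧ Nat.card L = q) ∨ (Nat.card H = q ∧ Nat.card L = p ^ 2)))
  obtain ⟨i, hi, hi'⟩ := (Nat.dvd_prime_pow hp).mp hnq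
  have hmod := card_sylow_modEq_one q G
  -- The number of Sylow q-subgroups is 1, p or p². If it is p, then q ∣ p - 1; were there also q
  -- Sylow p-subgroups, then p ∣ q - 1, and the two divisibilities contradict each other by size.
  interval_cases i
  · exact ⟨Q, P, normal_of_one Q (by simpa using hi'), hcompl.symm, Or.inr ⟨hQ, hP⟩⟩
  · apply cP
    apply normal_of_one
    rcases (Nat.dvd_prime hq).mp hnp with h | h
    · exact h
    · exfalso
      have hmod' := card_sylow_modEq_one p G
      rw [h] at hmod'
      rw [hi', pow_one] at hmod
      have h1 := (Nat.modEq_iff_dvd' hp.one_le).mp hmod.symm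
      have h2 := (Nat.modEq_iff_dvd' hq.one_le).mp hmod'.symm
      have h3 := Nat.le_of_dvd (Nat.sub_pos_of_lt hp.one_lt) h1
      have h4 := Nat.le_of_dvd (Nat.sub_pos_of_lt hq.one_lt) h2
      have := hp.one_lt
      omega
  -- With p² conjugates `Q` is its own normalizer, and it is abelian, so Burnside's transfer theorem
  -- provides a normal complement.
  · have hnorm : Subgroup.normalizer ((Q : Subgroup G) : Set G) = Q := by
      have h1 : Nat.card (Sylow q G) =
          (Subgroup.normalizer ((Q : Subgroup G) : Set G)).index := Q.card_eq_index_normalizer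
      rw [hi', ← hQi] at h1
      refine (Subgroup.eq_of_le_of_card_ge Subgroup.le_normalizer ?_).symm
      have h2 := (Subgroup.normalizer ((Q : Subgroup G) : Set G)).card_mul_index
      rw [← h1, ← (Q : Subgroup G).card_mul_index] at h2
      exact (Nat.eq_of_mul_eq_mul_right (hQi ▸ pow_pos hp.pos 2) h2).le
    have hcyc : IsCyclic Q := isCyclic_of_prime_card hQ
    have hcent : Subgroup.normalizer ((Q : Subgroup G) : Set G)
        ≤ Subgroup.centralizer ((Q : Subgroup G) : Set G) := by
      rw [hnorm]
      exact Subgroup.le_centralizer (Q : Subgroup G)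
    have hc := MonoidHom.ker_transferSylow_isComplement' Q hcent
    refine ⟨_, Q, inferInstance, hc, Or.inl ⟨?_, hQ⟩⟩
    have := hc.card_mul_card
    rw [hG, hQ] at this
    exact Nat.eq_of_mul_eq_mul_right hq.pos this

theorem splitTypes_union {p q : ℕ} (hp : p.Prime) (hq : q.Prime) (hpq : p ≠ q) :
    (Set.univ : Set (Quotient (groupIsoSetoid (p ^ 2 * q)))) =
      (splitTypes _ (Multiplicative (ZMod (p ^ 2))) (Multiplicative (ZMod q)) ∪
        splitTypes _ (Multiplicative (ZMod q)) (Multiplicative (ZMod (p ^ 2)))) ∪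
      (splitTypes _ (Multiplicative (ZMod p × ZMod p)) (Multiplicative (ZMod q)) ∪
        splitTypes _ (Multiplicative (ZMod q)) (Multiplicative (ZMod p × ZMod p))) := by
  have := Fact.mk hq
  refine (Set.eq_univ_of_forall fun t => ?_).symm
  induction t using Quotient.inductionOn with | _ G
  obtain ⟨G, hG⟩ := G
  have eq : ∀ L : Subgroup G, Nat.card L = q → Nonempty (L ≃* Multiplicative (ZMod q)) :=
    fun L hL => ⟨mulEquivOfPrimeCardEq hL (by simp)⟩
  obtain ⟨H, L, hn, hc, ⟨hH, hL⟩ | ⟨hH, hL⟩⟩ := exists_normal_complement hp hq hpq hG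
  · obtain ⟨f⟩ := eq L hL
    obtain ⟨⟨e⟩⟩ | ⟨⟨e⟩⟩ := mulEquiv_of_card_prime_sq hp hH
    · exact Or.inl (Or.inl (mk_mem_splitTypes.mpr (exists_mulEquiv_semidirectProduct hc e f)))
    · exact Or.inr (Or.inl (mk_mem_splitTypes.mpr (exists_mulEquiv_semidirectProduct hc e f)))
  · obtain ⟨f⟩ := eq H hH
    obtain ⟨⟨e⟩⟩ | ⟨⟨e⟩⟩ := mulEquiv_of_card_prime_sq hp hL
    · exact Or.inl (Or.inr (mk_mem_splitTypes.mpr (exists_mulEquiv_semidirectProduct hc f e)))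
    · exact Or.inr (Or.inr (mk_mem_splitTypes.mpr (exists_mulEquiv_semidirectProduct hc f e)))

/-! ### Assembling the four families -/

theorem SemidirectProduct.pow_mul_eq_one {N K : Type*} [Group N] [Group K] {φ : K →* MulAut N}
    {a b : ℕ} (hN : ∀ x : N, x ^ a = 1) (hK : ∀ x : K, x ^ b = 1) (g : N ⋊[φ] K) :
    g ^ (b * a) = 1 := by
  have h1 : (g ^ b).right = 1 := by
    have : SemidirectProduct.rightHom (g ^ b) = 1 := by rw [map_pow, hK]
    exact this
  have h2 : SemidirectProduct.inl (g ^ b).left = g ^ b := by ext <;> simp [h1]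
  rw [pow_mul, ← h2, ← map_pow, hN, map_one]

/-- A cyclic factor of order p² contains an element of order p², whereas with an elementary abelian
factor every element is killed by pq. -/
theorem splitTypes_disjoint {p q : ℕ} (hp : p.Prime) (hq : q.Prime) (hpq : p ≠ q) :
    Disjoint
      (splitTypes (p ^ 2 * q) (Multiplicative (ZMod (p ^ 2))) (Multiplicative (ZMod q)) ∪
        splitTypes _ (Multiplicative (ZMod q)) (Multiplicative (ZMod (p ^ 2))))
      (splitTypes _ (Multiplicative (ZMod p × ZMod p)) (Multiplicative (ZMod q)) ∪
        splitTypes _ (Multiplicative (ZMod q)) (Multiplicative (ZMod p × ZMod p))) := by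
  rw [Set.disjoint_left]
  intro t
  induction t using Quotient.inductionOn with | _ G
  intro h1 h2
  have hpow : ∀ g : G.1, g ^ (p * q) = 1 := by
    intro g
    have hN : ∀ x : Multiplicative (ZMod p × ZMod p), x ^ p = 1 := fun x => by
      have : p • x.toAdd = 0 := by ext <;> simp
      exact this
    have hK : ∀ x : Multiplicative (ZMod q), x ^ q = 1 := fun x => by
      have : q • x.toAdd = 0 := by simp
      exact this
    rcases h2 with h2 | h2
    · obtain ⟨φ, ⟨e⟩⟩ := mk_mem_splitTypes.mp h2
      apply e.injective
      rw [map_pow, map_one]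
      refine (congrArg (e g ^ ·) (mul_comm p q)).trans ?_
      exact SemidirectProduct.pow_mul_eq_one hN hK _
    · obtain ⟨φ, ⟨e⟩⟩ := mk_mem_splitTypes.mp h2
      apply e.injective
      rw [map_pow, map_one]
      exact SemidirectProduct.pow_mul_eq_one hK hN _
  have key : ∃ f : Multiplicative (ZMod (p ^ 2)) →* G.1, Function.Injective f := by
    rcases h1 with h1 | h1
    · obtain ⟨φ, ⟨e⟩⟩ := mk_mem_splitTypes.mp h1
      exact ⟨e.symm.toMonoidHom.comp SemidirectProduct.inl,
        e.symm.injective.comp SemidirectProduct.inl_injective⟩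
    · obtain ⟨φ, ⟨e⟩⟩ := mk_mem_splitTypes.mp h1
      exact ⟨e.symm.toMonoidHom.comp SemidirectProduct.inr,
        e.symm.injective.comp SemidirectProduct.inr_injective⟩
  obtain ⟨f, hf⟩ := key
  have h3 := hpow (f (Multiplicative.ofAdd 1))
  rw [← map_pow, ← map_one f] at h3
  have h4 : ((p * q : ℕ) : ZMod (p ^ 2)) = 0 := by
    have := hf h3
    rw [← ofAdd_nsmul, nsmul_one] at this
    exact this
  rw [ZMod.natCast_eq_zero_iff, sq] at h4
  exact hpq ((Nat.prime_dvd_prime_iff_eq hp hq).mp (Nat.dvd_of_mul_dvd_mul_left hp.pos h4))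

/-- The 2 accounts for the two direct products, each counted twice. Positivity of the counts yields
finiteness, since `Set.ncard` is 0 on infinite sets. -/
theorem numGroups_add_two {p q : ℕ} (hp : p.Prime) (hq : q.Prime) (hpq : p ≠ q)
    {c₁ c₂ c₃ c₄ : ℕ} (p₁ : 0 < c₁) (p₂ : 0 < c₂) (p₃ : 0 < c₃) (p₄ : 0 < c₄)
    (h₁ : (splitTypes (p ^ 2 * q) (Multiplicative (ZMod (p ^ 2)))
      (Multiplicative (ZMod q))).ncard = c₁)
    (h₂ : (splitTypes (p ^ 2 * q) (Multiplicative (ZMod p × ZMod p))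
      (Multiplicative (ZMod q))).ncard = c₂)
    (h₃ : (splitTypes (p ^ 2 * q) (Multiplicative (ZMod q))
      (Multiplicative (ZMod (p ^ 2)))).ncard = c₃)
    (h₄ : (splitTypes (p ^ 2 * q) (Multiplicative (ZMod q))
      (Multiplicative (ZMod p × ZMod p))).ncard = c₄) :
    numGroups (p ^ 2 * q) + 2 = c₁ + c₂ + c₃ + c₄ := by
  have f₁ := Set.finite_of_ncard_pos (h₁ ▸ p₁)
  have f₂ := Set.finite_of_ncard_pos (h₂ ▸ p₂)
  have f₃ := Set.finite_of_ncard_pos (h₃ ▸ p₃)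
  have f₄ := Set.finite_of_ncard_pos (h₄ ▸ p₄)
  have hco : (p ^ 2).Coprime q := Nat.Coprime.pow_left 2 ((Nat.coprime_primes hp hq).mpr hpq)
  have e₁ := Set.ncard_union_add_ncard_inter _ _ f₁ f₃
  have e₂ := Set.ncard_union_add_ncard_inter _ _ f₂ f₄
  rw [splitTypes_inter (by rw [natCard_multiplicative_zmod, natCard_multiplicative_zmod])
    (by rwa [natCard_multiplicative_zmod, natCard_multiplicative_zmod]), h₁, h₃] at e₁
  rw [splitTypes_inter (by rw [natCard_multiplicative_zmod_prod, natCard_multiplicative_zmod])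
    (by rwa [natCard_multiplicative_zmod_prod, natCard_multiplicative_zmod]), h₂, h₄] at e₂
  have e := Set.ncard_union_eq (splitTypes_disjoint hp hq hpq) (f₁.union f₃) (f₂.union f₄)
  rw [← splitTypes_union hp hq hpq, Set.ncard_univ] at e
  rw [numGroups]
  omega

/-! ### Actions through a cyclic automorphism group -/

/-- In a cyclic group a subgroup of order m is the whole kernel of the m-th power map. -/
theorem subgroup_eq_of_card_eq {A : Type*} [Group A] [IsCyclic A] [Finite A] {H H' : Subgroup A}
    (h : Nat.card H = Nat.card H') : H = H' := by
  let : CommGroup A := IsCyclic.commGroup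
  have key : ∀ L : Subgroup A, Nat.card L = Nat.card H →
      L = (powMonoidHom (Nat.card H) : A →* A).ker := by
    intro L hL
    refine Subgroup.eq_of_le_of_card_ge (fun x hx => ?_) ?_
    · rw [MonoidHom.mem_ker, powMonoidHom_apply, ← hL]
      exact congrArg Subtype.val (pow_card_eq_one' (x := (⟨x, hx⟩ : L)))
    · rw [IsCyclic.card_powMonoidHom_ker, hL]
      exact Nat.gcd_le_right _ Nat.card_pos
  exact (key H rfl).trans (key H' h.symm).symm

theorem MonoidHom.range_eq_zpowers {K A : Type*} [Group K] [Group A] (f : K →* A) {x : K}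
    (hx : Subgroup.zpowers x = ⊤) : f.range = Subgroup.zpowers (f x) := by
  rw [MonoidHom.range_eq_map, ← hx, MonoidHom.map_zpowers]

theorem MonoidHom.range_conj_eq {K A : Type*} [Group K] [Group A] [Finite A] [IsCyclic A]
    {f g : K →* A} (b : MulAut K) {a : A} (h : ∀ k, g (b k) = a * f k * a⁻¹) :
    f.range = g.range := by
  let : CommGroup A := IsCyclic.commGroup
  have h' : ∀ k, g (b k) = f k := fun k => by rw [h, mul_comm a, mul_inv_cancel_right]
  ext c
  constructor
  · rintro ⟨k, rfl⟩
    exact ⟨b k, h' k⟩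
  · rintro ⟨k, rfl⟩
    exact ⟨b⁻¹ k, by rw [← h', MulAut.apply_inv_self]⟩

/-- The images coincide, so for a generator `x` of `K` some power `n` takes `g x` to `f x`. This `n`
can be chosen prime to `r`, and then the n-th power map is the required automorphism of `K`. -/
theorem exists_mulAut_of_card_range_eq {K A : Type*} [CommGroup K] [IsCyclic K] [Finite K]
    [Group A] [IsCyclic A] [Finite A] {r : ℕ} (hr : r.Prime) (hK : IsPGroup r K)
    {f g : K →* A} (h : Nat.card f.range = Nat.card g.range) :
    ∃ b : MulAut K, ∀ k, g (b k) = f k := by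
  have := Fact.mk hr
  have hfg := subgroup_eq_of_card_eq h
  obtain ⟨x, hx⟩ := isCyclic_iff_exists_zpowers_eq_top.mp (inferInstance : IsCyclic K)
  have hfx := f.range_eq_zpowers hx
  have hgx := g.range_eq_zpowers hx
  rw [hfx, hgx, Nat.card_zpowers, Nat.card_zpowers] at h
  obtain ⟨n, hn, hco⟩ : ∃ n : ℕ, g x ^ n = f x ∧ (Nat.card K).Coprime n := by
    obtain ⟨m, hm⟩ := hK.exists_card_eq
    by_cases h1 : f x = 1
    · have h2 : g x = 1 := by rwa [← orderOf_eq_one_iff, ← h, orderOf_eq_one_iff]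
      exact ⟨1, by rw [h1, h2, one_pow], Nat.coprime_one_right _⟩
    · have hmem : f x ∈ Submonoid.powers (g x) := by
        rw [mem_powers_iff_mem_zpowers, ← hgx, ← hfg, hfx]
        exact Subgroup.mem_zpowers _
      obtain ⟨n, hn⟩ := hmem
      refine ⟨n, hn, ?_⟩
      rw [hm]
      refine Nat.Coprime.pow_left m ((Nat.Prime.coprime_iff_not_dvd hr).mpr fun hd => ?_)
      have hrg : r ∣ orderOf (g x) := by
        have h3 : orderOf (g x) ∣ r ^ m := hm ▸
          (orderOf_map_dvd g x).trans (orderOf_dvd_natCard x)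
        obtain ⟨i, hi, hi'⟩ := (Nat.dvd_prime_pow hr).mp h3
        rw [hi']
        refine dvd_pow_self r fun h0 => h1 ?_
        rw [← orderOf_eq_one_iff, h, hi', h0, pow_zero]
      have h4 : orderOf (f x) = orderOf (g x) / (orderOf (g x)).gcd n := by
        rw [← orderOf_pow, ← hn]
      have h5 : r ≤ (orderOf (g x)).gcd n :=
        Nat.le_of_dvd (Nat.gcd_pos_of_pos_left _ (orderOf_pos _)) (Nat.dvd_gcd hrg hd)
      -- If `r` divided `n`, the n-th power of `g x` would have smaller order than `g x`, but `f x`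
      -- has the same order.
      have h6 := Nat.div_lt_self (orderOf_pos (g x)) (hr.one_lt.trans_le h5)
      omega
  have hbij : Function.Bijective (powMonoidHom n : K →* K) := (powCoprime hco).bijective
  refine ⟨MulEquiv.ofBijective (powMonoidHom n) hbij, fun k => ?_⟩
  have hk : k ∈ Subgroup.zpowers x := hx ▸ Subgroup.mem_top k
  obtain ⟨i, rfl⟩ := hk
  rw [MulEquiv.ofBijective_apply, powMonoidHom_apply, map_pow, map_zpow, map_zpow, ← hn, ← zpow_natCast, ← zpow_natCast, zpow_comm]

theorem exists_card_range_eq {K A : Type*} [Group K] [IsCyclic K] [Finite K] [Group A]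
    [IsCyclic A] [Finite A] {d : ℕ} (hK : d ∣ Nat.card K) (hA : d ∣ Nat.card A) :
    ∃ f : K →* A, Nat.card f.range = d := by
  obtain ⟨x, hx⟩ := isCyclic_iff_exists_zpowers_eq_top.mp (inferInstance : IsCyclic K)
  obtain ⟨y, hy⟩ := isCyclic_iff_exists_zpowers_eq_top.mp (inferInstance : IsCyclic A)
  obtain ⟨m, hm⟩ := hA
  have hc : orderOf (y ^ m) = d := by
    have hpos : 0 < Nat.card A := Nat.card_pos
    rw [orderOf_pow, orderOf_eq_card_of_zpowers_eq_top hy, hm, Nat.gcd_mul_left_left]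
    refine Nat.mul_div_cancel _ (Nat.pos_of_ne_zero ?_)
    rintro rfl
    simp [hm] at hpos
  have hx' : ∀ k, k ∈ Subgroup.zpowers x := fun k => hx ▸ Subgroup.mem_top k
  refine ⟨monoidHomOfForallMemZpowers hx' (g' := y ^ m) ?_, ?_⟩
  · rw [hc, orderOf_eq_card_of_zpowers_eq_top hx]
    exact hK
  · rw [MonoidHom.range_eq_zpowers _ hx, monoidHomOfForallMemZpowers_apply_gen, Nat.card_zpowers,
      hc]

/-- The order of the image is a complete invariant here, and the orders that occur are the common
divisors of the orders of `K` and `MulAut N`. -/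
theorem ncard_splitTypes_of_isCyclic_mulAut {n : ℕ} {N K : Type} [CommGroup N] [CommGroup K]
    [Finite N] [Finite K] [IsCyclic K] [IsCyclic (MulAut N)]
    (hn : Nat.card N * Nat.card K = n) (h : (Nat.card N).Coprime (Nat.card K))
    {r : ℕ} (hr : r.Prime) (hK : IsPGroup r K) :
    (splitTypes n N K).ncard = ((Nat.card K).gcd (Nat.card (MulAut N))).divisors.card := by
  rw [ncard_splitTypes hn h (X := K →* MulAut N) (fun φ => φ) (fun φ => ⟨φ, .refl φ⟩)
    (fun φ => Nat.card φ.range), ← Set.ncard_coe_finset]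
  · congr 1
    ext d
    rw [Finset.mem_coe, Nat.mem_divisors, Nat.dvd_gcd_iff]
    constructor
    · rintro ⟨φ, rfl⟩
      exact ⟨⟨Subgroup.card_range_dvd φ, Subgroup.card_subgroup_dvd_card _⟩,
        (Nat.gcd_pos_of_pos_left _ Nat.card_pos).ne'⟩
    · rintro ⟨⟨h1, h2⟩, -⟩
      exact exists_card_range_eq h1 h2
  · intro φ ψ
    constructor
    · intro hc
      obtain ⟨b, hb⟩ := exists_mulAut_of_card_range_eq hr hK hc
      exact ⟨1, b, fun k => by simp [hb]⟩
    · rintro ⟨a, b, hab⟩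
      exact congrArg (fun H : Subgroup (MulAut N) => Nat.card H) (MonoidHom.range_conj_eq b hab)

/-- Take a preimage of `c` and a nonzero vector of the kernel as a basis: in these coordinates `f`
depends only on the first one. Two maps with the same image of order p thus differ by a change of
basis. -/
theorem exists_addEquiv_apply_eq_pow {A : Type*} [Group A] {p : ℕ} (hp : p.Prime)
    (f : Multiplicative (ZMod p × ZMod p) →* A) (hf : Nat.card f.range = p) {c : A}
    (hc : orderOf c = p) (hcf : c ∈ f.range) :
    ∃ e : (ZMod p × ZMod p) ≃+ (ZMod p × ZMod p),
      ∀ v, f (Multiplicative.ofAdd (e v)) = c ^ v.1.val := by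
  have := Fact.mk hp
  obtain ⟨x, hx⟩ := hcf
  have hker : Nat.card f.ker = p := by
    have h1 := f.ker.card_mul_index
    rw [Subgroup.index_ker, hf, natCard_multiplicative_zmod_prod, sq] at h1
    exact Nat.eq_of_mul_eq_mul_right hp.pos h1
  obtain ⟨y, hy, hy1⟩ := (Subgroup.bot_or_exists_ne_one f.ker).resolve_left fun h => by
    rw [h, Subgroup.card_bot] at hker
    exact hp.ne_one hker.symm
  let L : (ZMod p × ZMod p) →ₗ[ZMod p] (ZMod p × ZMod p) :=
    (LinearMap.toSpanSingleton (ZMod p) _ x.toAdd).coprod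
      (LinearMap.toSpanSingleton (ZMod p) _ y.toAdd)
  have f_smul : ∀ (a : ZMod p) (z : Multiplicative (ZMod p × ZMod p)),
      f (Multiplicative.ofAdd (a • z.toAdd)) = f z ^ a.val := by
    intro a z
    rw [← map_pow]
    congr 1
    have : a • z.toAdd = a.val • z.toAdd := by
      rw [← Nat.cast_smul_eq_nsmul (ZMod p), ZMod.natCast_zmod_val]
    rw [this]
    rfl
  have hL : ∀ v, f (Multiplicative.ofAdd (L v)) = c ^ v.1.val := by
    intro v
    have : L v = v.1 • x.toAdd + v.2 • y.toAdd := by simp [L]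
    rw [this, ofAdd_add, map_mul, f_smul, f_smul, hx, MonoidHom.mem_ker.mp hy, one_pow, mul_one]
  have hinj : Function.Injective L := by
    rw [injective_iff_map_eq_zero]
    intro v hv
    have h1 := hL v
    rw [hv, ofAdd_zero, map_one] at h1
    have h2 : v.1 = 0 := by
      rw [← ZMod.val_eq_zero]
      have hd := orderOf_dvd_of_pow_eq_one h1.symm
      rw [hc] at hd
      exact Nat.eq_zero_of_dvd_of_lt hd (ZMod.val_lt _)
    have h3 : v.2 • y.toAdd = 0 := by
      have : L v = v.1 • x.toAdd + v.2 • y.toAdd := by simp [L]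
      rw [← hv, this, h2, zero_smul, zero_add]
    exact Prod.ext h2 ((smul_eq_zero.mp h3).resolve_right fun h => hy1 h)
  exact ⟨AddEquiv.ofBijective L (Finite.injective_iff_bijective.mp hinj), hL⟩

theorem ncard_splitTypes_zmod_prod {n p : ℕ} (hp : p.Prime) {N : Type} [CommGroup N]
    [Finite N] [IsCyclic (MulAut N)] (hn : Nat.card N * p ^ 2 = n)
    (h : (Nat.card N).Coprime (p ^ 2)) :
    (splitTypes n N (Multiplicative (ZMod p × ZMod p))).ncard =
      (p.gcd (Nat.card (MulAut N))).divisors.card := by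
  have := Fact.mk hp
  have range_card : ∀ φ : Multiplicative (ZMod p × ZMod p) →* MulAut N,
      Nat.card φ.range ∣ p := by
    intro φ
    -- The image is cyclic, so its order is its exponent, which divides p.
    rw [← IsCyclic.exponent_eq_card]
    refine Monoid.exponent_dvd_of_forall_pow_eq_one ?_
    rintro ⟨_, v, rfl⟩
    ext1
    have hv : v ^ p = 1 := by
      have : p • v.toAdd = 0 := by ext <;> simp
      exact this
    exact (map_pow φ v p).symm.trans (by rw [hv, map_one]; rfl)
  have eqv : ∀ φ ψ : Multiplicative (ZMod p × ZMod p) →* MulAut N,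
      Nat.card φ.range = Nat.card ψ.range → ActionEquiv φ ψ := by
    intro φ ψ hc
    have hr := subgroup_eq_of_card_eq hc
    rcases (Nat.dvd_prime hp).mp (range_card φ) with h1 | h1
    · have hφ : φ = 1 := MonoidHom.range_eq_bot_iff.mp (Subgroup.card_eq_one.mp h1)
      have hψ : ψ = 1 := MonoidHom.range_eq_bot_iff.mp (Subgroup.card_eq_one.mp (hc ▸ h1))
      rw [hφ, hψ]
      exact .refl _
    · obtain ⟨⟨c, hcφ⟩, hord⟩ := exists_prime_orderOf_dvd_card' (G := φ.range) p h1.symm.dvd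
      rw [Subgroup.orderOf_mk] at hord
      obtain ⟨e, he⟩ := exists_addEquiv_apply_eq_pow hp φ h1 hord hcφ
      obtain ⟨e', he'⟩ := exists_addEquiv_apply_eq_pow hp ψ (hc ▸ h1) hord (hr ▸ hcφ)
      refine ⟨1, AddEquiv.toMultiplicative (e.symm.trans e'), fun k => ?_⟩
      have h2 := he (e.symm k.toAdd)
      rw [AddEquiv.apply_symm_apply] at h2
      have h3 := he' (e.symm k.toAdd)
      rw [one_mul, inv_one, mul_one]
      exact h3.trans h2.symm
  rw [ncard_splitTypes (by rwa [natCard_multiplicative_zmod_prod])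
    (by rwa [natCard_multiplicative_zmod_prod]) (fun φ => φ) (fun φ => ⟨φ, .refl φ⟩)
    (fun φ => Nat.card φ.range), ← Set.ncard_coe_finset]
  · congr 1
    ext d
    rw [Finset.mem_coe, Nat.mem_divisors, Nat.dvd_gcd_iff]
    constructor
    · rintro ⟨φ, rfl⟩
      exact ⟨⟨range_card φ, Subgroup.card_subgroup_dvd_card _⟩,
        (Nat.gcd_pos_of_pos_left _ hp.pos).ne'⟩
    · rintro ⟨⟨h1, h2⟩, -⟩
      obtain ⟨f, hf⟩ := exists_card_range_eq (K := Multiplicative (ZMod p)) (A := MulAut N)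
        (by rwa [natCard_multiplicative_zmod]) h2
      have hs : Function.Surjective
          (AddMonoidHom.toMultiplicative (AddMonoidHom.fst (ZMod p) (ZMod p))) :=
        fun x => ⟨Multiplicative.ofAdd (x.toAdd, 0), rfl⟩
      refine ⟨f.comp (AddMonoidHom.toMultiplicative (AddMonoidHom.fst (ZMod p) (ZMod p))), ?_⟩
      simp only
      rw [MonoidHom.range_comp, MonoidHom.range_eq_top.mpr hs, ← MonoidHom.range_eq_map, hf]
  · refine fun φ ψ => ⟨eqv φ ψ, ?_⟩
    rintro ⟨a, b, hab⟩
    exact congrArg (fun H : Subgroup (MulAut N) => Nat.card H) (MonoidHom.range_conj_eq b hab)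

/-! ### Actions of a group of prime order -/

theorem ActionEquiv.eq_one {N K : Type*} [Group N] [Group K] {ψ : K →* MulAut N}
    (h : ActionEquiv 1 ψ) : ψ = 1 := by
  obtain ⟨a, b, h⟩ := h
  ext1 k
  have := h (b⁻¹ k)
  rw [MulAut.apply_inv_self] at this
  simpa using this

theorem MonoidHom.range_card_of_prime {K A : Type*} [Group K] [Group A] {q : ℕ} (hq : q.Prime)
    (hK : Nat.card K = q) {f : K →* A} (hf : f ≠ 1) : Nat.card f.range = q :=
  ((Nat.dvd_prime hq).mp (hK ▸ Subgroup.card_range_dvd f)).resolve_left fun h =>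
    hf (MonoidHom.range_eq_bot_iff.mp (Subgroup.card_eq_one.mp h))

/-- A q-group acting on the cosets of `C`, whose number is prime to q, fixes one of them; the
stabilizer of that coset is a conjugate of `C`. -/
theorem exists_conj_mem_of_not_dvd_index {K A : Type*} [Group K] [Group A] {q : ℕ}
    (hq : q.Prime) (hK : Nat.card K = q) (C : Subgroup A) (hC : ¬ q ∣ C.index) (φ : K →* A) :
    ∃ a : A, ∀ k, a * φ k * a⁻¹ ∈ C := by
  have := Fact.mk hq
  let : MulAction K (A ⧸ C) := MulAction.compHom _ φ
  obtain ⟨x, hx⟩ := (IsPGroup.of_card (n := 1) (by rw [hK, pow_one]) :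
    IsPGroup q K).nonempty_fixed_point_of_prime_not_dvd_card (A ⧸ C) hC
  obtain ⟨a, rfl⟩ := QuotientGroup.mk_surjective x
  refine ⟨a⁻¹, fun k => ?_⟩
  have h1 : ((φ k * a : A) : A ⧸ C) = a := hx k
  have h2 := QuotientGroup.eq.mp h1.symm
  simpa [mul_assoc] using h2

/-- Every nontrivial action can be conjugated into the cyclic group `C`, where all images of order q
coincide. So the nontrivial actions form a single class, nonempty by Cauchy's theorem. -/
theorem ncard_splitTypes_of_not_dvd_index {n q : ℕ} (hq : q.Prime) {N : Type} [CommGroup N]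
    [Finite N] (hn : Nat.card N * q = n) (h : (Nat.card N).Coprime q)
    (C : Subgroup (MulAut N)) [IsCyclic C] (hC : ¬ q ∣ C.index)
    (hA : q ∣ Nat.card (MulAut N)) :
    (splitTypes n N (Multiplicative (ZMod q))).ncard = 2 := by
  classical
  have := Fact.mk hq
  have hK := natCard_multiplicative_zmod q
  have eqv : ∀ φ ψ : Multiplicative (ZMod q) →* MulAut N, φ ≠ 1 → ψ ≠ 1 → ActionEquiv φ ψ := by
    have key : ∀ φ : Multiplicative (ZMod q) →* MulAut N, φ ≠ 1 →
        ∃ f : Multiplicative (ZMod q) →* C, Nat.card f.range = q ∧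
          ActionEquiv φ (C.subtype.comp f) := by
      intro φ hφ
      obtain ⟨a, ha⟩ := exists_conj_mem_of_not_dvd_index hq hK C hC φ
      let f : Multiplicative (ZMod q) →* C :=
        ((MulAut.conj a).toMonoidHom.comp φ).codRestrict C ha
      have hf : ActionEquiv φ (C.subtype.comp f) := ⟨a, 1, fun k => rfl⟩
      refine ⟨f, MonoidHom.range_card_of_prime hq hK fun h1 => hφ ?_, hf⟩
      rw [h1, MonoidHom.comp_one] at hf
      exact hf.symm.eq_one
    intro φ ψ hφ hψ
    obtain ⟨f, hf, h1⟩ := key φ hφ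
    obtain ⟨g, hg, h2⟩ := key ψ hψ
    obtain ⟨b, hb⟩ := exists_mulAut_of_card_range_eq hq
      (IsPGroup.of_card (n := 1) (by rw [hK, pow_one])) (hf.trans hg.symm)
    refine (h1.trans ⟨1, b, fun k => ?_⟩).trans h2.symm
    simp [hb]
  obtain ⟨c, hc⟩ := exists_prime_orderOf_dvd_card' q hA
  obtain ⟨φ₀, hφ₀⟩ : ∃ φ : Multiplicative (ZMod q) →* MulAut N, φ ≠ 1 := by
    obtain ⟨f, hf⟩ := exists_card_range_eq (K := Multiplicative (ZMod q))
      (A := Subgroup.zpowers c) (d := q) (by rw [hK]) (by rw [Nat.card_zpowers, hc])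
    refine ⟨(Subgroup.zpowers c).subtype.comp f, fun h1 => hq.ne_one ?_⟩
    rw [← hf, Subgroup.card_eq_one, MonoidHom.range_eq_bot_iff]
    refine MonoidHom.ext fun k => ?_
    exact Subtype.ext (DFunLike.congr_fun h1 k)
  rw [ncard_splitTypes (by rwa [hK]) (by rwa [hK]) (fun φ => φ) (fun φ => ⟨φ, .refl φ⟩)
    (fun φ => if φ = 1 then 0 else 1)]
  · have : Set.range (fun φ : Multiplicative (ZMod q) →* MulAut N => if φ = 1 then 0 else 1) =
        ({0, 1} : Set ℕ) := by
      ext d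
      constructor
      · rintro ⟨φ, rfl⟩
        by_cases h1 : φ = 1 <;> simp [h1]
      · rintro (rfl | rfl)
        · exact ⟨1, if_pos rfl⟩
        · exact ⟨φ₀, if_neg hφ₀⟩
    rw [this, Set.ncard_pair zero_ne_one]
  · intro φ ψ
    by_cases h1 : φ = 1 <;> by_cases h2 : ψ = 1
    · simp [h1, h2, ActionEquiv.refl]
    · simp only [h1, h2, if_true, if_false]
      exact ⟨fun h => absurd h zero_ne_one, fun h => absurd h.eq_one h2⟩
    · simp only [h1, h2, if_true, if_false]
      exact ⟨fun h => absurd h one_ne_zero, fun h => absurd h.symm.eq_one h1⟩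
    · simp [h1, h2, eqv]

theorem ncard_splitTypes_of_not_dvd {n q : ℕ} (hq : q.Prime) {N : Type} [CommGroup N]
    [Finite N] (hn : Nat.card N * q = n) (h : (Nat.card N).Coprime q)
    (hA : ¬ q ∣ Nat.card (MulAut N)) :
    (splitTypes n N (Multiplicative (ZMod q))).ncard = 1 := by
  have := Fact.mk hq
  have hK := natCard_multiplicative_zmod q
  have h1 : ∀ φ : Multiplicative (ZMod q) →* MulAut N, φ = 1 := fun φ => by
    by_contra hφ
    exact hA (MonoidHom.range_card_of_prime hq hK hφ ▸ Subgroup.card_subgroup_dvd_card _)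
  rw [ncard_splitTypes (by rwa [hK]) (by rwa [hK]) (X := Unit) (fun _ => 1)
    (fun φ => ⟨(), h1 φ ▸ .refl _⟩) (fun _ => 0) (fun _ _ => ⟨fun _ => .refl _, fun _ => rfl⟩)]
  simp

/-! ### The automorphism group of (ℤ/p)² -/

/-- The action of the units of a ring on its additive group. -/
def unitsMulAut (R : Type*) [Ring R] : Rˣ →* MulAut (Multiplicative R) where
  toFun u := AddEquiv.toMultiplicative (DistribMulAction.toAddEquiv R u)
  map_one' := by
    ext x
    exact one_smul Rˣ x.toAdd
  map_mul' u v := by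
    ext x
    exact mul_smul u v x.toAdd

theorem unitsMulAut_apply {R : Type*} [Ring R] (u : Rˣ) (x : R) :
    unitsMulAut R u (Multiplicative.ofAdd x) = Multiplicative.ofAdd (u * x) := rfl

theorem unitsMulAut_injective (R : Type*) [Ring R] : Function.Injective (unitsMulAut R) := by
  intro u v h
  have := DFunLike.congr_fun h (Multiplicative.ofAdd 1)
  rw [unitsMulAut_apply, unitsMulAut_apply, mul_one, mul_one] at this
  exact Units.ext this

/-- Additive maps over ℤ/p are linear, so this is the order of GL₂(p). -/
theorem natCard_mulAut_zmod_prod {p : ℕ} (hp : p.Prime) :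
    Nat.card (MulAut (Multiplicative (ZMod p × ZMod p))) = (p ^ 2 - 1) * (p ^ 2 - p) := by
  have := Fact.mk hp
  let e₁ : MulAut (Multiplicative (ZMod p × ZMod p)) ≃
      ((ZMod p × ZMod p) ≃+ (ZMod p × ZMod p)) := AddEquiv.toMultiplicative.symm
  let e₂ : ((ZMod p × ZMod p) ≃+ (ZMod p × ZMod p)) ≃
      ((ZMod p × ZMod p) ≃ₗ[ZMod p] (ZMod p × ZMod p)) :=
    { toFun := fun e => { e with map_smul' := ZMod.map_smul e }
      invFun := fun e => e.toAddEquiv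
      left_inv := fun _ => rfl
      right_inv := fun _ => rfl }
  let t := LinearEquiv.finTwoArrow (ZMod p) (ZMod p)
  let e₃ : ((ZMod p × ZMod p) ≃ₗ[ZMod p] (ZMod p × ZMod p)) ≃
      ((Fin 2 → ZMod p) ≃ₗ[ZMod p] (Fin 2 → ZMod p)) :=
    { toFun := fun e => (t.trans e).trans t.symm
      invFun := fun e => (t.symm.trans e).trans t
      left_inv := fun e => by ext x <;> simp
      right_inv := fun e => by ext x; simp }
  have e := ((e₁.trans e₂).trans e₃).trans
    ((Matrix.GeneralLinearGroup.toLin (n := Fin 2) (R := ZMod p)).trans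
      (LinearMap.GeneralLinearGroup.generalLinearEquiv _ _)).symm.toEquiv
  rw [Nat.card_congr e, Matrix.card_GL_field, Fin.prod_univ_two, ZMod.card]
  simp

/-- The subgroup is the unit group of the field with p² elements, of order p² - 1, acting on that
field by multiplication. -/
theorem exists_isCyclic_subgroup_mulAut {p : ℕ} (hp : p.Prime) :
    ∃ C : Subgroup (MulAut (Multiplicative (ZMod p × ZMod p))), IsCyclic C ∧
      C.index = p ^ 2 - p := by
  have := Fact.mk hp
  have hcard := GaloisField.card p 2 two_ne_zero
  have : Finite (GaloisField p 2) := Nat.finite_of_card_ne_zero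
    (hcard ▸ pow_ne_zero 2 hp.ne_zero)
  obtain ⟨e⟩ := nonempty_addEquiv_zmod_prod hp hcard
  let f : (GaloisField p 2)ˣ →* MulAut (Multiplicative (ZMod p × ZMod p)) :=
    (MulAut.congr (AddEquiv.toMultiplicative e)).toMonoidHom.comp (unitsMulAut _)
  have hf : Function.Injective f :=
    (MulAut.congr (AddEquiv.toMultiplicative e)).injective.comp (unitsMulAut_injective _)
  refine ⟨f.range, isCyclic_of_surjective f.rangeRestrict f.rangeRestrict_surjective, ?_⟩
  have h1 := f.range.card_mul_index
  have h2 : Nat.card f.range = p ^ 2 - 1 := by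
    rw [← Nat.card_congr (MonoidHom.ofInjective hf).toEquiv, Nat.card_units, hcard]
  rw [h2, natCard_mulAut_zmod_prod hp] at h1
  exact Nat.eq_of_mul_eq_mul_left (Nat.sub_pos_of_lt (Nat.one_lt_pow two_ne_zero hp.one_lt)) h1

/-! ### Diagonal actions on (ℤ/p)² when q divides p - 1 -/

/-- Each nonzero entry of the matrix of `A` equates one of `x`, `y` with one of `x'`, `y'`. An
invertible matrix has no zero row or column, so both diagonal entries or both off-diagonal entries
are nonzero. -/
theorem diagonal_conj {F : Type*} [Field F] (A : (F × F) ≃ₗ[F] (F × F)) {x y x' y' : F}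
    (h : ∀ v : F × F, A (x * v.1, y * v.2) = (x' * (A v).1, y' * (A v).2)) :
    (x' = x ∧ y' = y) ∨ (x' = y ∧ y' = x) := by
  have h1 : x • A (1, 0) = (x' * (A (1, 0)).1, y' * (A (1, 0)).2) := by
    rw [← h, ← map_smul]; simp
  have h2 : y • A (0, 1) = (x' * (A (0, 1)).1, y' * (A (0, 1)).2) := by
    rw [← h, ← map_smul]; simp
  have hdet : ∀ s t : F, s • A (1, 0) + t • A (0, 1) = 0 → s = 0 ∧ t = 0 := by
    intro s t hst
    rw [← map_smul, ← map_smul, ← map_add] at hst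
    simpa using hst
  obtain ⟨⟨r, s⟩, hrs⟩ : ∃ z, z = A (1, 0) := ⟨_, rfl⟩
  obtain ⟨⟨t, w⟩, htw⟩ : ∃ z, z = A (0, 1) := ⟨_, rfl⟩
  rw [← hrs] at h1
  rw [← htw] at h2
  rw [← hrs, ← htw] at hdet
  have k1 := congrArg Prod.fst h1
  have k2 := congrArg Prod.snd h1
  have k3 := congrArg Prod.fst h2
  have k4 := congrArg Prod.snd h2
  simp only [Prod.smul_mk, smul_eq_mul, mul_eq_mul_right_iff] at k1 k2 k3 k4
  simp only [Prod.smul_mk, smul_eq_mul, Prod.mk_add_mk, Prod.mk_eq_zero] at hdet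
  have d1 : ¬ (r = 0 ∧ s = 0) := fun ⟨a, b⟩ => one_ne_zero (hdet 1 0 (by simp [a, b])).1
  have d2 : ¬ (t = 0 ∧ w = 0) := fun ⟨a, b⟩ => one_ne_zero (hdet 0 1 (by simp [a, b])).2
  have d3 : ¬ (s = 0 ∧ w = 0) := fun ⟨a, b⟩ => by
    have := hdet t (-r) ⟨by ring, by simp [a, b]⟩
    exact d2 ⟨this.1, b⟩
  have d4 : ¬ (r = 0 ∧ t = 0) := fun ⟨a, b⟩ => by
    have := hdet w (-s) ⟨by simp [a, b], by ring⟩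
    exact d2 ⟨b, this.1⟩
  grind

section Diagonal

variable {p q : ℕ}

/-- The diagonal action on `(ZMod p) ^ 2` through the powers `χ ^ a` and `χ ^ b` of a character. -/
def diagonalAction (χ : Multiplicative (ZMod q) →* (ZMod p)ˣ) (a b : ZMod q) :
    Multiplicative (ZMod q) →* MulAut (Multiplicative (ZMod p × ZMod p)) :=
  (unitsMulAut _).comp <| MulEquiv.prodUnits.symm.toMonoidHom.comp <|
    (χ.comp (AddMonoidHom.toMultiplicative (AddMonoidHom.mulLeft a))).prod
      (χ.comp (AddMonoidHom.toMultiplicative (AddMonoidHom.mulLeft b)))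

theorem diagonalAction_apply (χ : Multiplicative (ZMod q) →* (ZMod p)ˣ) (a b k : ZMod q)
    (v : ZMod p × ZMod p) :
    diagonalAction χ a b (Multiplicative.ofAdd k) (Multiplicative.ofAdd v) =
      Multiplicative.ofAdd ((χ (Multiplicative.ofAdd (a * k)) : ZMod p) * v.1,
        (χ (Multiplicative.ofAdd (b * k)) : ZMod p) * v.2) := rfl

/-- Pairs of exponents that agree up to a common unit factor and the order of the pair. -/
def ExponentEquiv (a b c d : ZMod q) : Prop :=
  ∃ u : (ZMod q)ˣ, (c * u = a ∧ d * u = b) ∨ (c * u = b ∧ d * u = a)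

/-- The common factor is an automorphism of ℤ/q, and the swap of exponents is the swap of
coordinates. -/
theorem actionEquiv_diagonalAction_of_exponentEquiv (χ : Multiplicative (ZMod q) →* (ZMod p)ˣ)
    {a b c d : ZMod q} (h : ExponentEquiv a b c d) :
    ActionEquiv (diagonalAction χ a b) (diagonalAction χ c d) := by
  obtain ⟨u, ⟨rfl, rfl⟩ | ⟨rfl, rfl⟩⟩ := h
  · refine ⟨1, unitsMulAut _ u, fun k => ?_⟩
    rw [one_mul, inv_one, mul_one]
    ext1 v
    change diagonalAction χ c d (Multiplicative.ofAdd (u * k.toAdd)) (Multiplicative.ofAdd v.toAdd)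
      = diagonalAction χ _ _ (Multiplicative.ofAdd k.toAdd) (Multiplicative.ofAdd v.toAdd)
    rw [diagonalAction_apply, diagonalAction_apply, mul_assoc, mul_assoc]
  · refine ⟨AddEquiv.toMultiplicative AddEquiv.prodComm, unitsMulAut _ u, fun k => ?_⟩
    rw [eq_mul_inv_iff_mul_eq]
    ext1 v
    change diagonalAction χ c d (Multiplicative.ofAdd (u * k.toAdd))
        (Multiplicative.ofAdd (v.toAdd.2, v.toAdd.1)) = AddEquiv.toMultiplicative AddEquiv.prodComm
        (diagonalAction χ _ _ (Multiplicative.ofAdd k.toAdd) (Multiplicative.ofAdd v.toAdd))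
    rw [diagonalAction_apply, diagonalAction_apply, mul_assoc, mul_assoc]
    rfl

theorem exponentEquiv_of_actionEquiv [Fact p.Prime] [Fact q.Prime]
    {χ : Multiplicative (ZMod q) →* (ZMod p)ˣ} (hχ : Function.Injective χ) {a b c d : ZMod q}
    (h : ActionEquiv (diagonalAction χ a b) (diagonalAction χ c d)) : ExponentEquiv a b c d := by
  obtain ⟨A, β, h⟩ := h
  let B : (ZMod p × ZMod p) ≃+ (ZMod p × ZMod p) := AddEquiv.toMultiplicative.symm A
  let L : (ZMod p × ZMod p) ≃ₗ[ZMod p] (ZMod p × ZMod p) :=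
    { B with map_smul' := ZMod.map_smul B }
  let u : ZMod q := (β (Multiplicative.ofAdd 1)).toAdd
  have hu : u ≠ 0 := fun h0 => by
    have h1 : β (Multiplicative.ofAdd 1) = 1 := h0
    rw [EmbeddingLike.map_eq_one_iff, ofAdd_eq_one] at h1
    exact one_ne_zero h1
  have h1 := h (Multiplicative.ofAdd 1)
  rw [eq_mul_inv_iff_mul_eq] at h1
  have h2 : ∀ v : ZMod p × ZMod p,
      L ((χ (Multiplicative.ofAdd a) : ZMod p) * v.1, (χ (Multiplicative.ofAdd b) : ZMod p) * v.2)
        = ((χ (Multiplicative.ofAdd (c * u)) : ZMod p) * (L v).1,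
          (χ (Multiplicative.ofAdd (d * u)) : ZMod p) * (L v).2) := by
    intro v
    have h3 := DFunLike.congr_fun h1 (Multiplicative.ofAdd v)
    change diagonalAction χ c d (Multiplicative.ofAdd u) (Multiplicative.ofAdd (L v)) =
      Multiplicative.ofAdd (L (diagonalAction χ a b (Multiplicative.ofAdd 1)
        (Multiplicative.ofAdd v)).toAdd) at h3
    rw [diagonalAction_apply, diagonalAction_apply, mul_one, mul_one] at h3
    exact h3.symm
  have inj : ∀ s t : ZMod q, (χ (Multiplicative.ofAdd s) : ZMod p) = χ (Multiplicative.ofAdd t) →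
      s = t := fun s t hst => hχ (Units.ext hst)
  refine ⟨Units.mk0 u hu, ?_⟩
  rcases diagonal_conj L h2 with ⟨h3, h4⟩ | ⟨h3, h4⟩
  · exact Or.inl ⟨inj _ _ h3, inj _ _ h4⟩
  · exact Or.inr ⟨inj _ _ h3, inj _ _ h4⟩

/-- Shifting `j` by 1 multiplies the sum by the value of `χ` at `k`, which is not 1. -/
theorem sum_character_eq_zero {R : Type*} [CommRing R] [IsDomain R] [Fact q.Prime]
    {χ : Multiplicative (ZMod q) →* Rˣ} (hχ : Function.Injective χ) {k : ZMod q} (hk : k ≠ 0) :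
    ∑ j : ZMod q, (χ (Multiplicative.ofAdd (j * k)) : R) = 0 := by
  have h1 : (χ (Multiplicative.ofAdd k) : R) ≠ 1 := fun h => by
    have h2 : χ (Multiplicative.ofAdd k) = χ 1 := by rw [map_one]; exact Units.ext h
    exact hk (hχ h2)
  have h2 : (∑ j : ZMod q, (χ (Multiplicative.ofAdd (j * k)) : R)) *
      χ (Multiplicative.ofAdd k) = ∑ j : ZMod q, (χ (Multiplicative.ofAdd (j * k)) : R) := by
    rw [Finset.sum_mul]
    refine Fintype.sum_equiv (Equiv.addRight (1 : ZMod q)) _ _ fun j => ?_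
    rw [← Units.val_mul, ← map_mul, ← ofAdd_add, Equiv.coe_addRight, add_mul, one_mul]
  have h3 : (∑ j : ZMod q, (χ (Multiplicative.ofAdd (j * k)) : R)) *
      (χ (Multiplicative.ofAdd k) - 1) = 0 := by rw [mul_sub, h2, mul_one, sub_self]
  exact (mul_eq_zero.mp h3).resolve_right (sub_ne_zero.mpr h1)

theorem span_eigenvectors_eq_top {F V : Type*} [Field F] [AddCommGroup V] [Module F V]
    [Fact q.Prime] (hqF : (q : F) ≠ 0) {χ : Multiplicative (ZMod q) →* Fˣ}
    (hχ : Function.Injective χ) (φ : Multiplicative (ZMod q) →* Module.End F V) :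
    Submodule.span F {v : V | ∃ a : ZMod q, ∀ k : ZMod q, φ (Multiplicative.ofAdd k) v =
      (χ (Multiplicative.ofAdd (a * k)) : F) • v} = ⊤ := by
  rw [eq_top_iff]
  intro v _
  -- `E j` is q times the projection of `v` to the eigenspace with exponent `j`. By orthogonality
  -- the projections add up to `v`, and q is invertible in `F`.
  let E : ZMod q → V := fun j => ∑ k : ZMod q,
    (χ (Multiplicative.ofAdd (j * -k)) : F) • φ (Multiplicative.ofAdd k) v
  have hE : ∀ j l, φ (Multiplicative.ofAdd l) (E j) =
      (χ (Multiplicative.ofAdd (j * l)) : F) • E j := by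
    intro j l
    simp only [E]
    rw [map_sum, Finset.smul_sum]
    refine Fintype.sum_equiv (Equiv.addRight l) _ _ fun k => ?_
    rw [map_smul, smul_smul, Equiv.coe_addRight, ← Units.val_mul, ← map_mul, ← ofAdd_add,
      ← Module.End.mul_apply, ← map_mul, ← ofAdd_add, add_comm l k]
    congr 5
    ring
  have hsum : ∑ j, E j = (q : F) • v := by
    simp only [E]
    rw [Finset.sum_comm]
    simp_rw [← Finset.sum_smul]
    rw [Finset.sum_eq_single 0]
    · simp
    · intro k _ hk
      rw [sum_character_eq_zero hχ (neg_ne_zero.mpr hk), zero_smul]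
    · simp
  rw [← inv_smul_smul₀ hqF v, ← hsum]
  exact Submodule.smul_mem _ _ (Submodule.sum_mem _ fun j _ => Submodule.subset_span ⟨j, hE j⟩)

end Diagonal

section Diagonal

variable {p q : ℕ}

theorem exists_eigenvector_basis {F : Type*} [Field F] {S : Set (F × F)}
    (hS : Submodule.span F S = ⊤) : ∃ x ∈ S, ∃ y ∈ S, ∀ s t : F, s • x + t • y = 0 →
      s = 0 ∧ t = 0 := by
  have not_le : ∀ x : F × F, ∃ y ∈ S, y ∉ Submodule.span F {x} := by
    intro x
    by_contra! hcon
    have h1 : Submodule.span F {x} = ⊤ := top_le_iff.mp (hS ▸ Submodule.span_le.mpr hcon)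
    have h2 := finrank_span_le_card (R := F) ({x} : Set (F × F))
    rw [h1, finrank_top, Module.finrank_prod, Module.finrank_self, Set.toFinset_singleton,
      Finset.card_singleton] at h2
    omega
  -- The span of 0 is trivial, so this only asks for a nonzero `x`.
  obtain ⟨x, hx, hx0⟩ := not_le 0
  obtain ⟨y, hy, hxy⟩ := not_le x
  refine ⟨x, hx, y, hy, fun s t hst => ?_⟩
  have ht : t = 0 := by
    by_contra ht
    refine hxy (Submodule.mem_span_singleton.mpr ⟨-(t⁻¹ * s), ?_⟩)
    have h3 : t⁻¹ • (s • x + t • y) = 0 := by rw [hst, smul_zero]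
    rw [smul_add, smul_smul, inv_smul_smul₀ ht] at h3
    rw [neg_smul]
    exact neg_eq_of_add_eq_zero_right h3
  rw [ht, zero_smul, add_zero] at hst
  refine ⟨(smul_eq_zero.mp hst).resolve_right fun h => hx0 ?_, ht⟩
  rw [h]
  exact Submodule.zero_mem _

theorem exists_actionEquiv_diagonalAction [Fact p.Prime] [Fact q.Prime] (hpq : p ≠ q)
    {χ : Multiplicative (ZMod q) →* (ZMod p)ˣ} (hχ : Function.Injective χ)
    (φ : Multiplicative (ZMod q) →* MulAut (Multiplicative (ZMod p × ZMod p))) :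
    ∃ a b : ZMod q, ActionEquiv φ (diagonalAction χ a b) := by
  let ρ : Multiplicative (ZMod q) →* Module.End (ZMod p) (ZMod p × ZMod p) :=
    { toFun := fun k => AddMonoidHom.toZModLinearMap p
        (AddEquiv.toMultiplicative.symm (φ k)).toAddMonoidHom
      map_one' := by
        rw [map_one]
        rfl
      map_mul' := fun k l => by
        rw [map_mul]
        rfl }
  have hρ : ∀ k v, ρ k v = (φ k (Multiplicative.ofAdd v)).toAdd := fun _ _ => rfl
  have hq0 : (q : ZMod p) ≠ 0 := by
    rw [Ne, ZMod.natCast_eq_zero_iff]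
    exact fun h => hpq ((Nat.prime_dvd_prime_iff_eq Fact.out Fact.out).mp h)
  obtain ⟨x, ⟨a, ha⟩, y, ⟨b, hb⟩, hxy⟩ :=
    exists_eigenvector_basis (span_eigenvectors_eq_top hq0 hχ ρ)
  let L : (ZMod p × ZMod p) →ₗ[ZMod p] (ZMod p × ZMod p) :=
    (LinearMap.toSpanSingleton (ZMod p) _ x).coprod (LinearMap.toSpanSingleton (ZMod p) _ y)
  have hL : ∀ v, L v = v.1 • x + v.2 • y := fun v => by simp [L]
  have hinj : Function.Injective L := by
    rw [injective_iff_map_eq_zero]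
    intro v hv
    rw [hL] at hv
    exact Prod.ext (hxy _ _ hv).1 (hxy _ _ hv).2
  let e : (ZMod p × ZMod p) ≃+ (ZMod p × ZMod p) :=
    AddEquiv.ofBijective L (Finite.injective_iff_bijective.mp hinj)
  refine ⟨a, b, ActionEquiv.symm ⟨AddEquiv.toMultiplicative e, 1, fun k => ?_⟩⟩
  rw [eq_mul_inv_iff_mul_eq]
  ext1 v
  have h1 : ρ k (L v.toAdd) = L ((χ (Multiplicative.ofAdd (a * k.toAdd)) : ZMod p) * v.toAdd.1,
      (χ (Multiplicative.ofAdd (b * k.toAdd)) : ZMod p) * v.toAdd.2) := by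
    have ha' := ha k.toAdd
    have hb' := hb k.toAdd
    rw [ofAdd_toAdd] at ha' hb'
    rw [hL, hL, map_add, map_smul, map_smul, ha', hb', smul_smul, smul_smul, mul_comm,
      mul_comm v.toAdd.2]
  exact congrArg Multiplicative.ofAdd h1

theorem exists_exponentEquiv [Fact q.Prime] (a b : ZMod q) :
    ExponentEquiv a b 0 0 ∨ ExponentEquiv a b 1 0 ∨ ∃ u : (ZMod q)ˣ, ExponentEquiv a b 1 u := by
  by_cases ha : a = 0 <;> by_cases hb : b = 0
  · exact Or.inl ⟨1, by simp [ha, hb]⟩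
  · exact Or.inr (Or.inl ⟨Units.mk0 b hb, by simp [ha]⟩)
  · exact Or.inr (Or.inl ⟨Units.mk0 a ha, by simp [hb]⟩)
  · refine Or.inr (Or.inr ⟨Units.mk0 (b / a) (div_ne_zero hb ha), Units.mk0 a ha, Or.inl ?_⟩)
    simp [ha]

/-- Representatives of the pairs of exponents. -/
def exponentPair : Option (Option (ZMod q)ˣ) → ZMod q × ZMod q
  | none => (0, 0)
  | some none => (1, 0)
  | some (some u) => (1, u)

/-- A numbering of the classes of pairs of exponents, from a logarithm on the units. -/
def exponentLabel (lg : (ZMod q)ˣ → ZMod (q - 1)) : Option (Option (ZMod q)ˣ) → ℕ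
  | none => 0
  | some none => 1
  | some (some u) => 2 + (lg u).valMinAbs.natAbs

/-- The pairs (1, u) and (1, v) are equivalent exactly when u = v or u = v⁻¹. The logarithm turns
inversion into negation, and the size of the least absolute residue separates elements precisely up
to sign. -/
theorem exponentLabel_eq_iff [Fact q.Prime]
    (lg : (ZMod q)ˣ ≃* Multiplicative (ZMod (q - 1))) (x y : Option (Option (ZMod q)ˣ)) :
    exponentLabel (fun u => (lg u).toAdd) x = exponentLabel (fun u => (lg u).toAdd) y ↔
      ExponentEquiv (exponentPair x).1 (exponentPair x).2
        (exponentPair y).1 (exponentPair y).2 := by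
  rcases x with _ | _ | u <;> rcases y with _ | _ | v <;>
    simp only [exponentLabel, exponentPair, ExponentEquiv]
  · simp
  · simp
  · simp
    omega
  · simp
  · simp
  · simp
    omega
  · simp
  · simp [u.ne_zero.symm]
    omega
  · rw [add_right_inj, ZMod.natAbs_valMinAbs_eq_natAbs_valMinAbs]
    have h1 : (lg u).toAdd = (lg v).toAdd ↔ u = v :=
      Multiplicative.toAdd.injective.eq_iff.trans lg.injective.eq_iff
    have h2 : (lg u).toAdd = -(lg v).toAdd ↔ u = v⁻¹ := by
      rw [← toAdd_inv, ← map_inv]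
      exact Multiplicative.toAdd.injective.eq_iff.trans lg.injective.eq_iff
    rw [h1, h2]
    constructor
    · rintro (rfl | rfl)
      · exact ⟨1, by simp⟩
      · exact ⟨v⁻¹, Or.inr ⟨one_mul _, v.mul_inv⟩⟩
    · rintro ⟨w, ⟨h3, h4⟩ | ⟨h3, h4⟩⟩
      · rw [one_mul] at h3
        rw [h3, mul_one] at h4
        exact Or.inl (Units.ext h4.symm)
      · rw [one_mul] at h3
        rw [h3] at h4
        exact Or.inr (eq_inv_of_mul_eq_one_right (Units.ext h4))

/-- Sizes of least absolute residues mod q - 1 run from 0 to (q - 1) / 2, and two further labels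
precede them. The floor makes this right for q = 2 as well, with 3 labels. -/
theorem range_exponentLabel (hq : 1 < q) (lg : (ZMod q)ˣ ≃* Multiplicative (ZMod (q - 1))) :
    Set.range (exponentLabel fun u => (lg u).toAdd) =
      (Finset.range (3 + (q - 1) / 2) : Set ℕ) := by
  have : NeZero (q - 1) := ⟨by omega⟩
  ext d
  rw [Finset.mem_coe, Finset.mem_range]
  constructor
  · rintro ⟨_ | _ | u, rfl⟩
    · simp only [exponentLabel]
      omega
    · simp only [exponentLabel]
      omega
    · have := ZMod.natAbs_valMinAbs_le (lg u).toAdd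
      simp only [exponentLabel]
      omega
  · intro hd
    match d, hd with
    | 0, _ => exact ⟨none, rfl⟩
    | 1, _ => exact ⟨some none, rfl⟩
    | d + 2, hd =>
      refine ⟨some (some (lg.symm (Multiplicative.ofAdd (d : ZMod (q - 1))))), ?_⟩
      simp only [exponentLabel, MulEquiv.apply_symm_apply, toAdd_ofAdd]
      rw [ZMod.valMinAbs_natCast_of_le_half (by omega), Int.natAbs_natCast, add_comm]

theorem ncard_splitTypes_of_dvd_sub_one (hp : p.Prime) (hq : q.Prime) (hpq : p ≠ q)
    (h : q ∣ p - 1) :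
    (splitTypes (p ^ 2 * q) (Multiplicative (ZMod p × ZMod p))
      (Multiplicative (ZMod q))).ncard = 3 + (q - 1) / 2 := by
  have := Fact.mk hp
  have := Fact.mk hq
  obtain ⟨χ, hχ⟩ := exists_card_range_eq (K := Multiplicative (ZMod q)) (A := (ZMod p)ˣ) (d := q)
    (by rw [natCard_multiplicative_zmod])
    (by rwa [Nat.card_units, Nat.card_zmod])
  have hinj : Function.Injective χ := by
    have h1 := χ.ker.card_mul_index
    rw [Subgroup.index_ker, hχ, natCard_multiplicative_zmod] at h1
    rw [← MonoidHom.ker_eq_bot_iff, ← Subgroup.card_eq_one]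
    exact Nat.eq_of_mul_eq_mul_right hq.pos (by rw [h1, one_mul])
  have lg : (ZMod q)ˣ ≃* Multiplicative (ZMod (q - 1)) := mulEquivOfCyclicCardEq (by
    rw [natCard_multiplicative_zmod, Nat.card_units, Nat.card_zmod])
  rw [ncard_splitTypes (by rw [natCard_multiplicative_zmod_prod, natCard_multiplicative_zmod])
    (by rw [natCard_multiplicative_zmod_prod, natCard_multiplicative_zmod]
        exact Nat.Coprime.pow_left 2 ((Nat.coprime_primes hp hq).mpr hpq))
    (fun x => diagonalAction χ (exponentPair x).1 (exponentPair x).2) (fun φ => ?_)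
    (exponentLabel fun u => (lg u).toAdd) (fun x y => ?_),
    range_exponentLabel hq.one_lt, Set.ncard_coe_finset, Finset.card_range]
  · obtain ⟨a, b, hab⟩ := exists_actionEquiv_diagonalAction hpq hinj φ
    rcases exists_exponentEquiv a b with h1 | h1 | ⟨u, h1⟩
    · exact ⟨none, hab.trans (actionEquiv_diagonalAction_of_exponentEquiv χ h1)⟩
    · exact ⟨some none, hab.trans (actionEquiv_diagonalAction_of_exponentEquiv χ h1)⟩
    · exact ⟨some (some u), hab.trans (actionEquiv_diagonalAction_of_exponentEquiv χ h1)⟩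
  · rw [exponentLabel_eq_iff]
    exact ⟨actionEquiv_diagonalAction_of_exponentEquiv χ, exponentEquiv_of_actionEquiv hinj⟩

end Diagonal

/-! ### Evaluating the counts -/

theorem isCyclic_mulAut_zmod_prime_sq {p : ℕ} (hp : p.Prime) :
    IsCyclic (MulAut (Multiplicative (ZMod (p ^ 2)))) := by
  have e := IsCyclic.mulAutMulEquiv (Multiplicative (ZMod (p ^ 2)))
  rw [natCard_multiplicative_zmod] at e
  have : IsCyclic (ZMod (p ^ 2))ˣ := by
    by_cases h : p = 2
    · rw [h]
      exact ZMod.isCyclic_units_four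
    · exact ZMod.isCyclic_units_of_prime_pow p hp h 2
  exact e.isCyclic.mpr this

theorem isCyclic_mulAut_zmod_prime {q : ℕ} (hq : q.Prime) :
    IsCyclic (MulAut (Multiplicative (ZMod q))) := by
  have := Fact.mk hq
  have e := IsCyclic.mulAutMulEquiv (Multiplicative (ZMod q))
  rw [natCard_multiplicative_zmod] at e
  exact e.isCyclic.mpr inferInstance

theorem natCard_mulAut_zmod (n : ℕ) [NeZero n] :
    Nat.card (MulAut (Multiplicative (ZMod n))) = n.totient := by
  rw [IsCyclic.card_mulAut, natCard_multiplicative_zmod]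

theorem card_divisors_gcd_prime {p n : ℕ} (hp : p.Prime) :
    (p.gcd n).divisors.card = 1 + w n p := by
  rw [w]
  split_ifs with h
  · rw [Nat.gcd_eq_left h, hp.divisors, Finset.card_pair hp.one_lt.ne]
  · rw [(hp.coprime_iff_not_dvd.mpr h).gcd_eq_one, Nat.divisors_one, Finset.card_singleton]

theorem card_divisors_gcd_prime_sq {p n : ℕ} (hp : p.Prime) :
    ((p ^ 2).gcd n).divisors.card = 1 + w n p + w n (p ^ 2) := by
  obtain ⟨k, hk, hg⟩ := (Nat.dvd_prime_pow hp).mp (Nat.gcd_dvd_left (p ^ 2) n)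
  have hw : ∀ i ≤ 2, (p ^ i ∣ n ↔ i ≤ k) := fun i hi => by
    rw [← Nat.pow_dvd_pow_iff_le_right hp.one_lt, ← hg, Nat.dvd_gcd_iff]
    exact ⟨fun h => ⟨pow_dvd_pow p hi, h⟩, fun h => h.2⟩
  have h1 := hw 1 one_le_two
  have h2 := hw 2 le_rfl
  rw [pow_one] at h1
  rw [hg, Nat.divisors_prime_pow hp, Finset.card_map, Finset.card_range, w, w]
  simp only [h1, h2]
  split_ifs <;> omega

/-- The number of isomorphism types of semidirect products of `(ZMod p) ^ 2` by `ZMod q`, `q` odd. -/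
theorem ncard_splitTypes_zmod_prod_zmod {p q : ℕ} (hp : p.Prime) (hq : q.Prime) (hpq : p ≠ q)
    (hq2 : 2 < q) :
    (splitTypes (p ^ 2 * q) (Multiplicative (ZMod p × ZMod p))
      (Multiplicative (ZMod q))).ncard = 1 + (q + 3) / 2 * w (p - 1) q + w (p + 1) q := by
  have := Fact.mk hp
  have hn : Nat.card (Multiplicative (ZMod p × ZMod p)) * q = p ^ 2 * q := by
    rw [natCard_multiplicative_zmod_prod]
  have hco : (Nat.card (Multiplicative (ZMod p × ZMod p))).Coprime q := by
    rw [natCard_multiplicative_zmod_prod]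
    exact Nat.Coprime.pow_left 2 ((Nat.coprime_primes hp hq).mpr hpq)
  have hqp : ¬ q ∣ p := fun h => hpq ((Nat.prime_dvd_prime_iff_eq hq hp).mp h).symm
  have hidx : p ^ 2 - p = p * (p - 1) := by rw [Nat.mul_sub_one, sq]
  have hsq : p ^ 2 - 1 = (p + 1) * (p - 1) := by
    have := Nat.sq_sub_sq p 1
    rwa [one_pow] at this
  -- As q is odd it cannot divide both p - 1 and p + 1, so at most one of the two indicators is
  -- nonzero. Oddness also gives 3 + (q - 1) / 2 = 1 + (q + 3) / 2.
  by_cases h1 : q ∣ p - 1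
  · have h2 : ¬ q ∣ p + 1 := fun h2 => by
      have h3 := Nat.dvd_sub h2 h1
      have h4 : p + 1 - (p - 1) = 2 := by have := hp.one_le; omega
      rw [h4] at h3
      exact absurd (Nat.le_of_dvd two_pos h3) (by omega)
    rw [ncard_splitTypes_of_dvd_sub_one hp hq hpq h1, w, w, if_pos h1, if_neg h2]
    have hodd := hq.eq_two_or_odd
    omega
  · by_cases h2 : q ∣ p + 1
    · obtain ⟨C, hC, hCi⟩ := exists_isCyclic_subgroup_mulAut hp
      rw [ncard_splitTypes_of_not_dvd_index hq hn hco C, w, w, if_neg h1, if_pos h2]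
      · simp
      -- The index is p(p - 1), prime to q since q ≠ p and q does not divide p - 1.
      · rw [hCi, hidx, hq.dvd_mul]
        exact fun h => h.elim hqp h1
      · rw [natCard_mulAut_zmod_prod hp, hsq]
        exact Dvd.dvd.mul_right (Dvd.dvd.mul_right h2 _) _
    · rw [ncard_splitTypes_of_not_dvd hq hn hco, w, w, if_neg h1, if_neg h2]
      · simp
      · rw [natCard_mulAut_zmod_prod hp, hsq, hidx, hq.dvd_mul, hq.dvd_mul, hq.dvd_mul]
        tauto

/-- The count with the number of actions on `(ZMod p) ^ 2` left open. -/
theorem numGroups_add_two_eq {p q c : ℕ} (hp : p.Prime) (hq : q.Prime) (hpq : p ≠ q)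
    (hpos : 0 < c)
    (hc : (splitTypes (p ^ 2 * q) (Multiplicative (ZMod p × ZMod p))
      (Multiplicative (ZMod q))).ncard = c) :
    numGroups (p ^ 2 * q) + 2 =
      (1 + w (p - 1) q) + c + (1 + w (q - 1) p + w (q - 1) (p ^ 2)) + (1 + w (q - 1) p) := by
  have := Fact.mk hp
  have := Fact.mk hq
  have hco : (p ^ 2).Coprime q := Nat.Coprime.pow_left 2 ((Nat.coprime_primes hp hq).mpr hpq)
  have hqp : ¬ q ∣ p := fun h => hpq ((Nat.prime_dvd_prime_iff_eq hq hp).mp h).symm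
  have := isCyclic_mulAut_zmod_prime_sq hp
  have := isCyclic_mulAut_zmod_prime hq
  have cp := natCard_multiplicative_zmod (p ^ 2)
  have cq := natCard_multiplicative_zmod q
  refine numGroups_add_two hp hq hpq (by omega) hpos (by omega) (by omega) ?_ hc ?_ ?_
  · rw [ncard_splitTypes_of_isCyclic_mulAut (by rw [cp, cq]) (by rwa [cp, cq]) hq
      (IsPGroup.of_card (n := 1) (by rw [cq, pow_one])), cq, natCard_mulAut_zmod,
      card_divisors_gcd_prime hq, Nat.totient_prime_pow hp two_pos, w, w]
    have : q ∣ p ^ (2 - 1) * (p - 1) ↔ q ∣ p - 1 := by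
      rw [hq.dvd_mul, pow_one]
      tauto
    simp only [this]
  · rw [ncard_splitTypes_of_isCyclic_mulAut (by rw [cp, cq, mul_comm])
      (by rw [cp, cq]; exact hco.symm) hp (IsPGroup.of_card cp), cp, natCard_mulAut_zmod,
      Nat.totient_prime hq, card_divisors_gcd_prime_sq hp]
  · rw [ncard_splitTypes_zmod_prod hp (by rw [cq, mul_comm]) (by rw [cq]; exact hco.symm),
      natCard_mulAut_zmod, Nat.totient_prime hq, card_divisors_gcd_prime hp]

theorem mainTheorem4 (p q : ℕ) (hp : p.Prime) (hq : q.Prime) (hpq : p ≠ q) :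
    (q = 2 → numGroups (p ^ 2 * q) = 5) ∧
    (2 < q →
      (numGroups (p ^ 2 * q) : ℚ) =
        2 + ((q : ℚ) + 5) / 2 * (w (p - 1) q : ℚ) + (w (p + 1) q : ℚ)
          + 2 * (w (q - 1) p : ℚ) + (w (q - 1) (p ^ 2) : ℚ)) := by
  constructor
  · rintro rfl
    have hodd := hp.eq_two_or_odd.resolve_left hpq
    have h2 : 2 ∣ p - 1 := by omega
    -- For q = 2 the four counts are 2, 3, 1 and 1, with sum 7 = 5 + 2.
    have h := numGroups_add_two_eq hp hq hpq (by norm_num)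
      (ncard_splitTypes_of_dvd_sub_one hp hq hpq h2)
    have w1 : w (p - 1) 2 = 1 := if_pos h2
    have w2 : w (2 - 1) p = 0 := if_neg fun h => hp.one_lt.ne' (Nat.dvd_one.mp h)
    have w3 : w (2 - 1) (p ^ 2) = 0 :=
      if_neg fun h => hp.one_lt.ne' (Nat.dvd_one.mp ((dvd_pow_self p two_ne_zero).trans h))
    omega
  · intro hq2
    have h := numGroups_add_two_eq hp hq hpq (by omega)
      (ncard_splitTypes_zmod_prod_zmod hp hq hpq hq2)
    obtain ⟨m, hm⟩ : ∃ m, q = 2 * m + 1 := hq.odd_of_ne_two (by omega)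
    -- The division is exact because q is odd. The coefficient (q + 3) / 2 becomes (q + 5) / 2 with
    -- the one nontrivial action on the cyclic group of order p².
    have hdiv : (q + 3) / 2 = m + 2 := by omega
    rw [hdiv] at h
    have h' := congrArg (Nat.cast : ℕ → ℚ) h
    push_cast at h'
    have hm' : (q : ℚ) = 2 * m + 1 := by exact_mod_cast hm
    linear_combination h' - (w (p - 1) q : ℚ) / 2 * hm'
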